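/- For an invertible measure preserving transformation $T$ of a probability space $(X,\mathcal B,\mu)$, a function $f\in L^1(\mu)$ with $f\ge 0$, an integer $n\ge 1$ and $x\in X$, put $$\mathbf N_n(f)(x)=\#\left\{k\ge 1:\ \frac{f(T^kx)}{k}>\frac1n\right\}\in\{0,1,2,\dots\}\cup\{\infty\}.$$ Then $$\sup_{(X,\mathcal B,\mu,T)}\ \sup_{f\ge 0,\ \|f\|_1=1}\ \sup_{\lambda>0}\ \lambda\cdot\mu\left\{x:\ \sup_{n\ge 1}\frac{\mathbf N_n(f)(x)}{n}>\lambda\right\}=\infty,$$ where the first supremum is over all such probability spaces and transformations $T$; that is, the counting maximal operator $f\mapsto\sup_n \mathbf N_n(f)/n$ satisfies no weak type $(1,1)$ inequality uniformly over measure preserving systems. Moreover, the supremum is already infinite when the systems are restricted to the dyadic rotations $x\mapsto x+2^{-J}$ mod $1$, $J=0,1,2,\dots$, of $[0,1)$ with Lebesgue measure. -/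

import Mathlib

open MeasureTheory
open scoped ENNReal NNReal

noncomputable section

namespace CountingProblem

/-- `N_n(f)(x) = #{k ≥ 1 : f (T^k x) / k > 1 / n}`, a possibly infinite cardinality. -/
def count {X : Type*} (T : X → X) (f : X → ℝ) (n : ℕ) (x : X) : ℕ∞ :=
  Set.encard {k : ℕ | 1 ≤ k ∧ f (T^[k] x) / (k : ℝ) > 1 / (n : ℝ)}

/-- The counting maximal function `sup_{n ≥ 1} N_n(f)(x) / n`. -/
def maximalCount {X : Type*} (T : X → X) (f : X → ℝ) (x : X) : ℝ≥0∞ :=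
  ⨆ (n : ℕ) (_ : 1 ≤ n), (count T f n x : ℝ≥0∞) / (n : ℝ≥0∞)

/-- The best constant in the weak type (1,1) inequality for the counting maximal function of one
system: the supremum of `lam * μ {x | sup_n N_n(f)(x) / n > lam}` over all `lam > 0` and all
nonnegative `f` in `L¹(μ)` of norm one. -/
def weakTypeConst {X : Type*} [MeasurableSpace X] (μ : Measure X) (T : X → X) : ℝ≥0∞ :=
  ⨆ (f : X → ℝ) (_ : Integrable f μ) (_ : 0 ≤ᵐ[μ] f) (_ : eLpNorm f 1 μ = 1)
    (lam : ℝ≥0) (_ : 0 < lam),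
    (lam : ℝ≥0∞) * μ {x | maximalCount T f x > (lam : ℝ≥0∞)}

/-- The dyadic rotation `x ↦ x + 2^{-J}` mod 1. -/
def dyadicRotation (J : ℕ) (x : UnitAddCircle) : UnitAddCircle :=
  x + (((2 : ℝ) ^ J)⁻¹ : ℝ)

end CountingProblem

end

namespace CountingProblem

open Finset

/-! ### Parities of base `q` digits -/

/-! On an interval of integers, superpose `K` levels of spikes. Those of level `i` have height twice
their spacing `P = (q ^ V) ^ (i + 1)` and are kept only over blocks whose `M` inspected base `q`
digits are all odd. Each level has mean `2 * 2 ^ (-M)`, so `K = 2 ^ (M + 2)` gives total mean `8`.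

From `x`, with threshold `1 / n` and `n = q ^ (s + 1)`, a kept spike of level `i` counts up to
distance `2 * P * n`. Let `d` be the largest index of an even inspected digit at `x`, or `0`. If `s`
lies between the inspected places `d` and `d + 1`, then in the next window of `n` blocks the higher
inspected digits stay odd and the lower ones run freely, so a proportion `2 ^ (-d)` of the blocks is
kept. The mean of `2 ^ (-d)` is `2 ^ (-M) * (1 + M / 2)`: a factor linear in `M` is won.

One `s` has to serve all levels. The inspected places of level `i` have spacing `2 * (M + 1) ^ i`
and start where the coarser levels have put the scale, so finer levels only refine it within a gap
(`scale_between`). Each level reads its own base `q ^ V` digit, which yields the exponential moment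
bound `sum_exp_neg_gain_le`. The proof rests on the count `exists_many_large_spikes`, the norm
`sum_spike` and the proportion of good points `card_goodPoints`; cells of length `2 ^ (-J)` carry
them to the circle. -/

lemma sum_range_mul_eq {β : Type*} [AddCommMonoid β] (a b : ℕ) (F : ℕ → β) :
    ∑ x ∈ range (a * b), F x = ∑ y ∈ range b, ∑ D ∈ range a, F (D + a * y) := by
  induction b with
  | zero => simp
  | succ b ih =>
    rw [mul_add_one, sum_range_add, ih, sum_range_succ]
    simp [add_comm]

/-- As `q` is even, the parity of `z / q ^ p` is that of the digit of `z` at place `p`, which digits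
at places `V` and beyond do not affect. -/
lemma odd_add_mul_div_pow {q V p : ℕ} (hq : Even q) (hq0 : 0 < q) (hp : p < V) (D y : ℕ) :
    Odd ((D + q ^ V * y) / q ^ p) ↔ Odd (D / q ^ p) := by
  obtain ⟨c, rfl⟩ := Nat.exists_eq_add_of_lt hp
  have h : q ^ (p + c + 1) * y = q ^ p * (q ^ (c + 1) * y) := by ring
  rw [h, Nat.add_mul_div_left _ _ (pow_pos hq0 p), Nat.odd_add]
  have h2 : Even (q ^ (c + 1) * y) := (hq.pow_of_ne_zero (Nat.succ_ne_zero c)).mul_right y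
  simp [h2]

lemma sum_range_odd {q : ℕ} (hq : Even q) :
    (∑ e ∈ range q, if Odd e then (1 : ℝ) else 0) = q / 2 := by
  obtain ⟨r, rfl⟩ := hq
  induction r with
  | zero => simp
  | succ r ih =>
    rw [show r + 1 + (r + 1) = (r + r) + 1 + 1 by ring, sum_range_succ, sum_range_succ, ih]
    have h1 : ¬ Odd (r + r) := by simp
    have h2 : Odd (r + r + 1) := by simp
    simp only [h1, h2, if_true, if_false]
    push_cast
    ring

/-- The proportion of `D < q ^ m` whose digits at the places of `S` are all odd. -/
lemma sum_forall_odd_digits {q : ℕ} (hq : Even q) (hq0 : 0 < q) (m : ℕ) (S : Finset ℕ)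
    (hS : ∀ p ∈ S, p < m) :
    (∑ D ∈ range (q ^ m), if ∀ p ∈ S, Odd (D / q ^ p) then (1 : ℝ) else 0) =
      (q : ℝ) ^ m * (1 / 2) ^ #S := by
  induction m generalizing S with
  | zero =>
    obtain rfl : S = ∅ := eq_empty_of_forall_notMem fun p hp => absurd (hS p hp) (by simp)
    simp
  | succ m ih =>
    have key : ∀ e D, D < q ^ m → ((if ∀ p ∈ S, Odd ((D + q ^ m * e) / q ^ p) then (1 : ℝ) else 0) =
        (if m ∈ S then if Odd e then (1 : ℝ) else 0 else 1) *
          if ∀ p ∈ S.erase m, Odd (D / q ^ p) then (1 : ℝ) else 0) := by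
      intro e D hD
      have h1 : ∀ p ∈ S.erase m, (Odd ((D + q ^ m * e) / q ^ p) ↔ Odd (D / q ^ p)) := by
        intro p hp
        have hp' := mem_erase.1 hp
        exact odd_add_mul_div_pow hq hq0
          (lt_of_le_of_ne (Nat.lt_succ_iff.1 (hS p hp'.2)) hp'.1) D e
      have h2 : (D + q ^ m * e) / q ^ m = e := by
        rw [Nat.add_mul_div_left _ _ (pow_pos hq0 m), Nat.div_eq_of_lt hD, zero_add]
      have h3 : (∀ p ∈ S, Odd ((D + q ^ m * e) / q ^ p)) ↔
          (m ∈ S → Odd e) ∧ ∀ p ∈ S.erase m, Odd (D / q ^ p) := by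
        constructor
        · intro h
          exact ⟨fun hm => h2 ▸ h m hm, fun p hp => (h1 p hp).1 (h p (mem_of_mem_erase hp))⟩
        · rintro ⟨ha, hb⟩ p hp
          by_cases hpm : p = m
          · subst hpm
            rw [h2]
            exact ha hp
          · exact (h1 p (mem_erase.2 ⟨hpm, hp⟩)).2 (hb p (mem_erase.2 ⟨hpm, hp⟩))
      rw [if_congr h3 rfl rfl]
      split_ifs <;> first | norm_num; done | (exfalso; tauto)
    rw [pow_succ, sum_range_mul_eq]
    have hE : ∀ p ∈ S.erase m, p < m := fun p hp =>
      lt_of_le_of_ne (Nat.lt_succ_iff.1 (hS p (mem_of_mem_erase hp))) (ne_of_mem_erase hp)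
    have h4 : ∀ e ∈ range q, (∑ D ∈ range (q ^ m),
        if ∀ p ∈ S, Odd ((D + q ^ m * e) / q ^ p) then (1 : ℝ) else 0) =
        (if m ∈ S then if Odd e then (1 : ℝ) else 0 else 1) *
          ((q : ℝ) ^ m * (1 / 2) ^ #(S.erase m)) := by
      intro e _
      rw [← ih _ hE, mul_sum]
      exact sum_congr rfl fun D hD => key e D (mem_range.1 hD)
    rw [sum_congr rfl h4, ← sum_mul]
    by_cases hm : m ∈ S
    · simp only [hm, if_true]
      rw [sum_range_odd hq, ← card_erase_add_one hm]
      ring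
    · simp only [hm, if_false, erase_eq_of_notMem hm]
      simp
      ring

lemma sum_forall_odd_progression {q : ℕ} (hq : Even q) (hq0 : 0 < q) (m H U : ℕ) (hU : 0 < U)
    (A : Finset ℕ) (hA : ∀ a ∈ A, H + a * U < m) :
    (∑ D ∈ range (q ^ m), if ∀ a ∈ A, Odd (D / q ^ (H + a * U)) then (1 : ℝ) else 0) =
      (q : ℝ) ^ m * (1 / 2) ^ #A := by
  have h := sum_forall_odd_digits hq hq0 m (A.image fun a => H + a * U) (by simpa using hA)
  rw [card_image_of_injective] at h
  · simpa using h
  · intro a b hab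
    exact Nat.eq_of_mul_eq_mul_right hU (Nat.add_left_cancel hab)

/-- Used with `c = q - 1` to bound the points at which a carry can occur. -/
lemma card_filter_digit_eq_le (q : ℕ) (hq0 : 0 < q) (L p c : ℕ) (hp : p < L) :
    (∑ x ∈ range (q ^ L), if x / q ^ p % q = c then (1 : ℝ) else 0) ≤ (q : ℝ) ^ L / q := by
  obtain ⟨r, rfl⟩ := Nat.exists_eq_add_of_lt hp
  have hq0' : (q : ℝ) ≠ 0 := by positivity
  rw [show q ^ (p + r + 1) = q ^ p * (q * q ^ r) by ring, sum_range_mul_eq]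
  have h1 : ∀ y ∈ range (q * q ^ r), (∑ D ∈ range (q ^ p),
      if (D + q ^ p * y) / q ^ p % q = c then (1 : ℝ) else 0) =
      (q : ℝ) ^ p * if y % q = c then (1 : ℝ) else 0 := by
    intro y _
    have : ∀ D ∈ range (q ^ p), (if (D + q ^ p * y) / q ^ p % q = c then (1 : ℝ) else 0) =
        if y % q = c then (1 : ℝ) else 0 := by
      intro D hD
      rw [Nat.add_mul_div_left _ _ (pow_pos hq0 p), Nat.div_eq_of_lt (mem_range.1 hD), zero_add]
    rw [sum_congr rfl this]
    simp
  rw [sum_congr rfl h1, ← mul_sum, sum_range_mul_eq]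
  have h2 : ∀ y ∈ range (q ^ r),
      (∑ D ∈ range q, if (D + q * y) % q = c then (1 : ℝ) else 0) ≤ 1 := by
    intro y _
    have : ∀ D ∈ range q, (if (D + q * y) % q = c then (1 : ℝ) else 0) =
        if D = c then (1 : ℝ) else 0 := by
      intro D hD
      rw [Nat.add_mul_mod_self_left, Nat.mod_eq_of_lt (mem_range.1 hD)]
    rw [sum_congr rfl this, sum_ite_eq']
    split_ifs <;> norm_num
  calc _ ≤ (q : ℝ) ^ p * ∑ y ∈ range (q ^ r), (1 : ℝ) := by
        gcongr with y hy
        exact h2 y hy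
    _ = _ := by
        simp
        field_simp
        ring

/-! ### The adaptive scale -/

/-- The largest `a ≤ M` such that the base `q` digit of `z` at place `H + a * U` is even, and `0`
if there is none. -/
def depth (q M H U z : ℕ) : ℕ := Nat.findGreatest (fun a => Even (z / q ^ (H + a * U))) M

/-- The scale read off from the `n` lowest base `q ^ V` digits of `z`, the higher ones first. -/
def scale (q M V : ℕ) : ℕ → ℕ → ℕ → ℕ
  | 0, _, _ => 0
  | n + 1, U, z => scale q M V n (U * (M + 1)) (z / q ^ V) +
      depth q M (scale q M V n (U * (M + 1)) (z / q ^ V)) U z * U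

/-- The sum of `2 ^ (-depth)` over the `n` levels that enter the definition of `scale`. -/
noncomputable def gain (q M V : ℕ) : ℕ → ℕ → ℕ → ℝ
  | 0, _, _ => 0
  | n + 1, U, z => (1 / 2) ^ depth q M (scale q M V n (U * (M + 1)) (z / q ^ V)) U z +
      gain q M V n (U * (M + 1)) (z / q ^ V)

lemma depth_le (q M H U z : ℕ) : depth q M H U z ≤ M := Nat.findGreatest_le _

lemma odd_of_depth_lt {q M H U z a : ℕ} (h : depth q M H U z < a) (ha : a ≤ M) :
    Odd (z / q ^ (H + a * U)) :=
  Nat.not_even_iff_odd.1 (Nat.findGreatest_is_greatest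
    (P := fun a => Even (z / q ^ (H + a * U))) h ha)

lemma depth_le_of_odd {q M H U z a : ℕ} (h : ∀ b ∈ Ioc a M, Odd (z / q ^ (H + b * U))) :
    depth q M H U z ≤ a := by
  by_contra! hlt
  have h1 : Even (z / q ^ (H + depth q M H U z * U)) :=
    Nat.findGreatest_of_ne_zero (P := fun a => Even (z / q ^ (H + a * U))) (n := M) rfl
      (show depth q M H U z ≠ 0 by omega)
  exact Nat.not_even_iff_odd.2 (h _ (mem_Ioc.2 ⟨hlt, depth_le ..⟩)) h1

/-- Since `M * U + U = U * (M + 1)`, a refinement by at most `M` steps of length `U` stays within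
one step of the next coarser level. -/
lemma scale_add_le (q M V n U z : ℕ) : scale q M V n U z + U ≤ U * (M + 1) ^ n := by
  induction n generalizing U z with
  | zero => simp [scale]
  | succ n ih =>
    have h1 := ih (U * (M + 1)) (z / q ^ V)
    have h2 : depth q M (scale q M V n (U * (M + 1)) (z / q ^ V)) U z * U ≤ M * U :=
      Nat.mul_le_mul_right _ (depth_le ..)
    simp only [scale]
    calc _ ≤ scale q M V n (U * (M + 1)) (z / q ^ V) + U * (M + 1) := by linarith
      _ ≤ _ := h1
      _ = _ := by ring

lemma scale_add_mul_lt {q M V n U z a : ℕ} (hU : 0 < U) (hV : U * (M + 1) ^ (n + 1) ≤ V)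
    (ha : a ≤ M) : scale q M V n (U * (M + 1)) z + a * U < V := by
  have h1 := scale_add_le q M V n (U * (M + 1)) z
  have h2 : a * U ≤ M * U := Nat.mul_le_mul_right _ ha
  have h3 : U * (M + 1) * (M + 1) ^ n = U * (M + 1) ^ (n + 1) := by ring
  nlinarith

/-- All inspected places lie below `V`; this is the source of independence between levels. -/
lemma depth_congr {q M V H U D y : ℕ} (hq : Even q) (hq0 : 0 < q) (hH : H + M * U < V) :
    depth q M H U (D + q ^ V * y) = depth q M H U D := by
  have key : ∀ a ≤ M, (Even ((D + q ^ V * y) / q ^ (H + a * U)) ↔ Even (D / q ^ (H + a * U))) := by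
    intro a ha
    have h2 : a * U ≤ M * U := Nat.mul_le_mul_right _ ha
    rw [← Nat.not_odd_iff_even, ← Nat.not_odd_iff_even,
      odd_add_mul_div_pow hq hq0 (by omega : H + a * U < V)]
  apply le_antisymm
  · refine depth_le_of_odd fun b hb => ?_
    have hb := mem_Ioc.1 hb
    exact Nat.not_even_iff_odd.1 fun h =>
      Nat.not_even_iff_odd.2 (odd_of_depth_lt hb.1 hb.2) ((key b hb.2).1 h)
  · refine depth_le_of_odd fun b hb => ?_
    have hb := mem_Ioc.1 hb
    exact Nat.not_even_iff_odd.1 fun h =>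
      Nat.not_even_iff_odd.2 (odd_of_depth_lt hb.1 hb.2) ((key b hb.2).2 h)

/-- Telescoping writes `2 ^ (-d)` as `2 ^ (-M)` plus the terms `2 ^ (-(a + 1))` with `d ≤ a < M`,
and `d ≤ a` holds as soon as the inspected digits beyond `a` are odd. -/
lemma le_half_pow_depth (q M H U z : ℕ) :
    (1 / 2 : ℝ) ^ M + ∑ a ∈ range M, (if ∀ b ∈ Ioc a M, Odd (z / q ^ (H + b * U)) then (1 : ℝ) else 0)
      * (1 / 2) ^ (a + 1) ≤ (1 / 2) ^ depth q M H U z := by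
  set d := depth q M H U z with hd
  have hdM : d ≤ M := depth_le ..
  have h1 : ∑ a ∈ range M, (if ∀ b ∈ Ioc a M, Odd (z / q ^ (H + b * U)) then (1 : ℝ) else 0)
      * (1 / 2) ^ (a + 1) ≤ ∑ a ∈ range M, if d ≤ a then (1 / 2 : ℝ) ^ (a + 1) else 0 := by
    refine sum_le_sum fun a _ => ?_
    by_cases h : ∀ b ∈ Ioc a M, Odd (z / q ^ (H + b * U))
    · rw [if_pos h, if_pos (depth_le_of_odd h), one_mul]
    · rw [if_neg h, zero_mul]
      split_ifs <;> positivity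
  have h2 : ∀ N, d ≤ N → (1 / 2 : ℝ) ^ N + ∑ a ∈ range N, (if d ≤ a then (1 / 2 : ℝ) ^ (a + 1) else 0)
      = (1 / 2) ^ d := by
    intro N hN
    induction N, hN using Nat.le_induction with
    | base =>
      rw [sum_eq_zero, add_zero]
      intro a ha
      rw [if_neg (by simpa using ha)]
    | succ N hN ih =>
      rw [sum_range_succ, if_pos hN, ← ih]
      ring
  linarith [h2 M hdM]

/-- The expectation of `2 ^ (-depth)` is larger than `2 ^ (-M)` by a factor linear in `M`. -/
lemma le_sum_half_pow_depth {q M V H U : ℕ} (hq : Even q) (hq0 : 0 < q) (hU : 0 < U)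
    (hH : H + M * U < V) :
    (q : ℝ) ^ V * ((1 / 2) ^ M * (1 + M / 2)) ≤
      ∑ D ∈ range (q ^ V), (1 / 2 : ℝ) ^ depth q M H U D := by
  refine le_trans (le_of_eq ?_) (sum_le_sum fun D _ => le_half_pow_depth q M H U D)
  rw [sum_add_distrib, sum_comm]
  have h : ∀ a ∈ range M, (∑ D ∈ range (q ^ V),
      (if ∀ b ∈ Ioc a M, Odd (D / q ^ (H + b * U)) then (1 : ℝ) else 0) * (1 / 2) ^ (a + 1)) =
      (q : ℝ) ^ V * (1 / 2) ^ (M + 1) := by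
    intro a ha
    have haM := mem_range.1 ha
    -- The `M - a` odd digits have probability `2 ^ (-(M - a))`, so every `a` contributes the same
    -- amount.
    rw [← sum_mul, sum_forall_odd_progression hq hq0 V H U hU, Nat.card_Ioc, mul_assoc, ← pow_add]
    · congr 2
      omega
    · intro b hb
      have h2 : b * U ≤ M * U := Nat.mul_le_mul_right _ (mem_Ioc.1 hb).2
      omega
  rw [sum_congr rfl h]
  simp
  ring

lemma exp_neg_le_one_sub_half {t : ℝ} (h0 : 0 ≤ t) (h1 : t ≤ 1) : Real.exp (-t) ≤ 1 - t / 2 := by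
  have h2 := Real.quadratic_le_exp_of_nonneg h0
  rw [Real.exp_neg, inv_le_comm₀ (Real.exp_pos _) (by linarith)]
  refine le_trans ?_ h2
  rw [inv_le_iff_one_le_mul₀ (by linarith)]
  nlinarith [mul_nonneg h0 h0, mul_nonneg (mul_nonneg h0 h0) (sub_nonneg.2 h1)]

/-- An exponential moment bound for the sum of the gains of the levels. -/
lemma sum_exp_neg_gain_le {q M V : ℕ} (hq : Even q) (hq0 : 0 < q) (n U : ℕ) (hU : 0 < U)
    (hV : U * (M + 1) ^ n ≤ V) :
    ∑ z ∈ range ((q ^ V) ^ n), Real.exp (-gain q M V n U z) ≤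
      ((q : ℝ) ^ V) ^ n * Real.exp (-(n * ((1 / 2) ^ M * (1 + M / 2) / 2))) := by
  induction n generalizing U with
  | zero => simp [gain]
  | succ n ih =>
    set m : ℝ := (1 / 2) ^ M * (1 + M / 2) with hm
    have ih' := ih (U * (M + 1)) (by positivity) (by rw [pow_succ] at hV; linarith)
    have h1 : ∀ y ∈ range ((q ^ V) ^ n), ∑ D ∈ range (q ^ V),
        Real.exp (-gain q M V (n + 1) U (D + q ^ V * y)) ≤
        (q : ℝ) ^ V * Real.exp (-(m / 2)) * Real.exp (-gain q M V n (U * (M + 1)) y) := by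
      intro y _
      -- `H` depends on `y` alone; for fixed `y` the lowest digit `D` is still uniform.
      set H := scale q M V n (U * (M + 1)) y with hHdef
      have hH : H + M * U < V := scale_add_mul_lt hU hV le_rfl
      have h2 : ∀ D ∈ range (q ^ V), Real.exp (-gain q M V (n + 1) U (D + q ^ V * y)) ≤
          (1 - (1 / 2) ^ depth q M H U D / 2) * Real.exp (-gain q M V n (U * (M + 1)) y) := by
        intro D hD
        have hdiv : (D + q ^ V * y) / q ^ V = y := by
          rw [Nat.add_mul_div_left _ _ (pow_pos hq0 V), Nat.div_eq_of_lt (mem_range.1 hD), zero_add]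
        rw [gain, hdiv, ← hHdef, depth_congr hq hq0 hH, neg_add, Real.exp_add]
        gcongr
        exact exp_neg_le_one_sub_half (by positivity) (pow_le_one₀ (by norm_num) (by norm_num))
      refine (sum_le_sum h2).trans ?_
      rw [← sum_mul]
      gcongr
      rw [sum_sub_distrib, ← sum_div]
      have h3 := le_sum_half_pow_depth hq hq0 hU hH
      have h4 := Real.add_one_le_exp (-(m / 2))
      have h5 : (0 : ℝ) ≤ (q : ℝ) ^ V := by positivity
      simp only [sum_const, card_range, nsmul_eq_mul, mul_one, Nat.cast_pow]
      nlinarith [mul_le_mul_of_nonneg_left h4 h5]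
    rw [pow_succ', sum_range_mul_eq]
    refine (sum_le_sum h1).trans ?_
    rw [← mul_sum]
    calc _ ≤ (q : ℝ) ^ V * Real.exp (-(m / 2)) *
          (((q : ℝ) ^ V) ^ n * Real.exp (-(n * (m / 2)))) := by gcongr
      _ = ((q : ℝ) ^ V) ^ (n + 1) * (Real.exp (-(m / 2)) * Real.exp (-(n * (m / 2)))) := by ring
      _ = _ := by
        rw [← Real.exp_add]
        congr 2
        push_cast
        ring

/-! ### The function on the integers -/

/-- All `M` digits of `z` that are inspected by `scale` at the lowest of `n + 1` levels are odd. -/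
def Active (q M V n U z : ℕ) : Prop :=
  ∀ a ∈ Icc 1 M, Odd (z / q ^ (scale q M V n (U * (M + 1)) (z / q ^ V) + a * U))

instance (q M V n U z : ℕ) : Decidable (Active q M V n U z) := by
  unfold Active
  infer_instance

/-- The superposition over `K` levels of sparse spikes, those of level `i` having height
`2 * (q ^ V) ^ (i + 1)`. -/
noncomputable def spike (q M V K y : ℕ) : ℝ :=
  ∑ i ∈ range K, if y % (q ^ V) ^ (i + 1) = i ∧
    Active q M V (K - 1 - i) (2 * (M + 1) ^ i) (y / (q ^ V) ^ (i + 1))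
    then 2 * ((q : ℝ) ^ V) ^ (i + 1) else 0

lemma spike_nonneg (q M V K y : ℕ) : 0 ≤ spike q M V K y :=
  sum_nonneg fun i _ => by split_ifs <;> positivity

lemma gain_eq_sum (q M V n U z : ℕ) :
    gain q M V n U z = ∑ i ∈ range n, (1 / 2 : ℝ) ^
      depth q M (scale q M V (n - 1 - i) (U * (M + 1) ^ i * (M + 1)) (z / (q ^ V) ^ i / q ^ V))
        (U * (M + 1) ^ i) (z / (q ^ V) ^ i) := by
  induction n generalizing U z with
  | zero => simp [gain]
  | succ n ih =>
    rw [sum_range_succ', gain, ih, add_comm]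
    congr 1
    · refine sum_congr rfl fun i _ => ?_
      have h1 : n + 1 - 1 - (i + 1) = n - 1 - i := by omega
      have h2 : z / q ^ V / (q ^ V) ^ i = z / (q ^ V) ^ (i + 1) := by
        rw [Nat.div_div_eq_div_mul, pow_succ']
      have h3 : U * (M + 1) * (M + 1) ^ i = U * (M + 1) ^ (i + 1) := by ring
      rw [h1, h2, h3]
    · simp

/-- The final scale lies between the scale reached at level `i` and the next place that this level
inspects. -/
lemma scale_between (q M V n U z i : ℕ) (hi : i ≤ n) :
    scale q M V (n - i) (U * (M + 1) ^ i) (z / (q ^ V) ^ i) ≤ scale q M V n U z ∧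
      scale q M V n U z + U ≤
        scale q M V (n - i) (U * (M + 1) ^ i) (z / (q ^ V) ^ i) + U * (M + 1) ^ i := by
  induction i with
  | zero => simp
  | succ i ih =>
    obtain ⟨h1, h2⟩ := ih (by omega)
    have h3 : n - i = (n - (i + 1)) + 1 := by omega
    have h4 : z / (q ^ V) ^ i / q ^ V = z / (q ^ V) ^ (i + 1) := by
      rw [Nat.div_div_eq_div_mul, pow_succ]
    have h5 : U * (M + 1) ^ i * (M + 1) = U * (M + 1) ^ (i + 1) := by ring
    rw [h3, scale, h4, h5] at h1 h2
    have h6 := Nat.mul_le_mul_right (U * (M + 1) ^ i) (depth_le q M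
      (scale q M V (n - (i + 1)) (U * (M + 1) ^ (i + 1)) (z / (q ^ V) ^ (i + 1)))
      (U * (M + 1) ^ i) (z / (q ^ V) ^ i))
    constructor
    · exact le_trans (Nat.le_add_right _ _) h1
    · rw [← h5]
      rw [← h5] at h6 h2
      nlinarith

lemma succ_div_of_mod_ne {q X : ℕ} (hq0 : 0 < q) (h : X % q ≠ q - 1) : (X + 1) / q = X / q := by
  rw [Nat.succ_div, if_neg, add_zero]
  intro hd
  apply h
  have h1 := Nat.mod_lt X hq0
  have h2 := Nat.div_add_mod X q
  obtain ⟨c, hc⟩ := hd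
  have h3 : q * (X / q) + (X % q + 1) = q * c := by omega
  have h4 : q ∣ X % q + 1 := (Nat.dvd_add_right (Dvd.intro _ rfl)).1 (h3 ▸ Dvd.intro _ rfl)
  have h5 := Nat.le_of_dvd (by omega) h4
  omega

/-- In the block of length `q ^ m` following that of `z₀`, the digits beyond place `m` are those of
`z₀` unless there is a carry at place `m`. -/
lemma next_block_div {q m z₀ D p : ℕ} (hq0 : 0 < q) (hc : z₀ / q ^ m % q ≠ q - 1) (hD : D < q ^ m)
    (hp : m + 1 ≤ p) : (D + q ^ m * (z₀ / q ^ m + 1)) / q ^ p = z₀ / q ^ p := by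
  obtain ⟨r, rfl⟩ := Nat.exists_eq_add_of_le hp
  have h : q ^ (m + 1 + r) = q ^ m * (q * q ^ r) := by ring
  rw [h, ← Nat.div_div_eq_div_mul, ← Nat.div_div_eq_div_mul, Nat.add_mul_div_left _ _ (pow_pos hq0 m),
    Nat.div_eq_of_lt hD, zero_add, succ_div_of_mod_ne hq0 hc, ← Nat.div_div_eq_div_mul,
    ← Nat.div_div_eq_div_mul]

lemma active_next_block {q M V n U z₀ s D : ℕ} (hq : Even q) (hq0 : 0 < q)
    (hc : z₀ / q ^ (s + 1) % q ≠ q - 1) (hsV : s + 2 ≤ V) (hD : D < q ^ (s + 1))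
    (h1 : scale q M V n (U * (M + 1)) (z₀ / q ^ V) +
      depth q M (scale q M V n (U * (M + 1)) (z₀ / q ^ V)) U z₀ * U ≤ s)
    (h2 : s + 2 ≤ scale q M V n (U * (M + 1)) (z₀ / q ^ V) +
      depth q M (scale q M V n (U * (M + 1)) (z₀ / q ^ V)) U z₀ * U + U)
    (hodd : ∀ a ∈ Icc 1 (depth q M (scale q M V n (U * (M + 1)) (z₀ / q ^ V)) U z₀),
      Odd (D / q ^ (scale q M V n (U * (M + 1)) (z₀ / q ^ V) + a * U))) :
    Active q M V n U (D + q ^ (s + 1) * (z₀ / q ^ (s + 1) + 1)) := by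
  intro a ha
  rw [next_block_div hq0 hc hD hsV]
  set H := scale q M V n (U * (M + 1)) (z₀ / q ^ V)
  set d := depth q M H U z₀ with hd
  have ha := mem_Icc.1 ha
  -- Places up to `d` are at most `s` and run freely with `D`; later ones are at least `s + 2` and
  -- keep the digits of `z₀`. Place `s + 1`, whose digit changes, is never inspected.
  rcases le_or_gt a d with had | had
  · have h3 : a * U ≤ d * U := Nat.mul_le_mul_right _ had
    rw [odd_add_mul_div_pow hq hq0 (by omega)]
    exact hodd a (mem_Icc.2 ⟨ha.1, had⟩)
  · have h3 : (d + 1) * U ≤ a * U := Nat.mul_le_mul_right _ had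
    rw [add_one_mul] at h3
    rw [next_block_div hq0 hc hD (by omega)]
    exact odd_of_depth_lt had ha.2

/-- The spikes of one level that are seen from `x`. -/
lemma exists_spikes {q M V K n U i x s : ℕ} (hq : Even q) (hq0 : 0 < q) (hU : 0 < U)
    (hc : x / (q ^ V) ^ (i + 1) / q ^ (s + 1) % q ≠ q - 1) (hsV : s + 2 ≤ V)
    (hiQ : i < q ^ V) (hiK : i < K) (hx : x < (q ^ V) ^ (K + 1))
    (h1 : scale q M V n (U * (M + 1)) (x / (q ^ V) ^ (i + 1) / q ^ V) + depth q M
      (scale q M V n (U * (M + 1)) (x / (q ^ V) ^ (i + 1) / q ^ V)) U (x / (q ^ V) ^ (i + 1)) * U ≤ s)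
    (h2 : s + 2 ≤ scale q M V n (U * (M + 1)) (x / (q ^ V) ^ (i + 1) / q ^ V) + depth q M
      (scale q M V n (U * (M + 1)) (x / (q ^ V) ^ (i + 1) / q ^ V)) U (x / (q ^ V) ^ (i + 1)) * U + U) :
    ∃ B : Finset ℕ, (#B : ℝ) = (q : ℝ) ^ (s + 1) * (1 / 2) ^ depth q M
        (scale q M V n (U * (M + 1)) (x / (q ^ V) ^ (i + 1) / q ^ V)) U (x / (q ^ V) ^ (i + 1)) ∧
      ∀ y ∈ B, x < y ∧ y < x + 2 * (q ^ V) ^ (i + 1) * q ^ (s + 1) ∧ y < (q ^ V) ^ (K + 1) ∧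
        y % (q ^ V) ^ (i + 1) = i ∧ Active q M V n U (y / (q ^ V) ^ (i + 1)) := by
  set P := (q ^ V) ^ (i + 1) with hP
  have hP0 : 0 < P := by positivity
  have hiP : i < P := lt_of_lt_of_le hiQ (Nat.le_self_pow (Nat.succ_ne_zero i) _)
  set z₀ := x / P with hz₀
  set H := scale q M V n (U * (M + 1)) (z₀ / q ^ V) with hH
  set d := depth q M H U z₀ with hd
  have hqm : 0 < q ^ (s + 1) := by positivity
  -- The window is the aligned block of length `q ^ (s + 1)` after the one containing `z₀`; the
  -- offset `i` is the residue carried by level `i`.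
  refine ⟨((range (q ^ (s + 1))).filter fun D => ∀ a ∈ Icc 1 d, Odd (D / q ^ (H + a * U))).image
    fun D => i + P * (D + q ^ (s + 1) * (z₀ / q ^ (s + 1) + 1)), ?_, ?_⟩
  · rw [card_image_of_injective]
    · have h3 := sum_forall_odd_progression hq hq0 (s + 1) H U hU (Icc 1 d) (by
        intro a ha
        have h3 : a * U ≤ d * U := Nat.mul_le_mul_right _ (mem_Icc.1 ha).2
        omega)
      rw [sum_boole] at h3
      simpa using h3
    · intro a b hab
      have h3 := Nat.eq_of_mul_eq_mul_left hP0 (Nat.add_left_cancel hab)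
      exact Nat.add_right_cancel h3
  · intro y hy
    obtain ⟨D, hD, rfl⟩ := mem_image.1 hy
    obtain ⟨hD, hodd⟩ := mem_filter.1 hD
    have hD := mem_range.1 hD
    have hact := active_next_block hq hq0 hc hsV hD h1 h2 hodd
    have hdiv := next_block_div hq0 hc hD hsV
    set z := D + q ^ (s + 1) * (z₀ / q ^ (s + 1) + 1) with hz
    have e1 : x % P < P := Nat.mod_lt _ hP0
    have e2 : P * z₀ + x % P = x := Nat.div_add_mod x P
    have e3 : z₀ % q ^ (s + 1) < q ^ (s + 1) := Nat.mod_lt _ hqm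
    have e4 : q ^ (s + 1) * (z₀ / q ^ (s + 1)) + z₀ % q ^ (s + 1) = z₀ := Nat.div_add_mod _ _
    have e8 : q ^ (s + 1) * (z₀ / q ^ (s + 1) + 1) =
      q ^ (s + 1) * (z₀ / q ^ (s + 1)) + q ^ (s + 1) := mul_add_one _ _
    have e5 : z₀ + 1 ≤ z := by omega
    have e6 : z + 1 ≤ z₀ + 2 * q ^ (s + 1) := by
      rw [hz, e8]
      linarith [Nat.succ_le_of_lt hD, Nat.mul_div_le z₀ (q ^ (s + 1))]
    have e7 : (i + P * z) / P = z := by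
      rw [Nat.add_mul_div_left _ _ hP0, Nat.div_eq_of_lt hiP, zero_add]
    refine ⟨?_, ?_, ?_, ?_, ?_⟩
    · have := Nat.mul_le_mul_left P e5
      rw [mul_add_one] at this
      omega
    · have := Nat.mul_le_mul_left P e6
      rw [mul_add_one, mul_add P z₀] at this
      rw [show 2 * P * q ^ (s + 1) = P * (2 * q ^ (s + 1)) by ring]
      omega
    -- Without a carry, `y` and `x` agree in the digits above the block, so `y` stays in range.
    · have hK : (q ^ V) ^ (K + 1) = (P * q ^ V) * (q ^ V) ^ (K - 1 - i) := by
        rw [hP, ← pow_succ, ← pow_add]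
        congr 1
        omega
      rw [hK, mul_comm (P * q ^ V)] at hx ⊢
      rw [← Nat.div_lt_iff_lt_mul (by positivity), ← Nat.div_div_eq_div_mul] at hx ⊢
      rw [e7, hdiv]
      exact hx
    · rw [Nat.add_mul_mod_self_left, Nat.mod_eq_of_lt hiP]
    · rw [e7]
      exact hact

/-- Away from carries, the values of `spike` beyond `x` are large at many places. -/
lemma exists_many_large_spikes {q M V K x : ℕ} (hq : Even q) (hq0 : 0 < q)
    (hV : 2 * (M + 1) ^ K ≤ V) (hK : K ≤ q ^ V) (hx : x < (q ^ V) ^ (K + 1))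
    (hc : ∀ p < V * (K + 1), x / q ^ p % q ≠ q - 1) :
    ∃ B : Finset ℕ, (q : ℝ) ^ (scale q M V K 2 (x / q ^ V) + 1) * gain q M V K 2 (x / q ^ V) ≤ #B ∧
      ∀ k ∈ B, 1 ≤ k ∧ x + k < (q ^ V) ^ (K + 1) ∧
        (k : ℝ) < spike q M V K (x + k) * q ^ (scale q M V K 2 (x / q ^ V) + 1) := by
  set s := scale q M V K 2 (x / q ^ V) with hs
  have hsV : s + 2 ≤ V := (scale_add_le q M V K 2 (x / q ^ V)).trans hV
  have hdiv : ∀ i, x / q ^ V / (q ^ V) ^ i = x / (q ^ V) ^ (i + 1) := fun i => by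
    rw [Nat.div_div_eq_div_mul, pow_succ']
  have hex : ∀ i ∈ range K, ∃ B : Finset ℕ, (#B : ℝ) = (q : ℝ) ^ (s + 1) * (1 / 2) ^
      depth q M (scale q M V (K - 1 - i) (2 * (M + 1) ^ i * (M + 1)) (x / q ^ V / (q ^ V) ^ i / q ^ V))
        (2 * (M + 1) ^ i) (x / q ^ V / (q ^ V) ^ i) ∧
      ∀ y ∈ B, x < y ∧ y < x + 2 * (q ^ V) ^ (i + 1) * q ^ (s + 1) ∧ y < (q ^ V) ^ (K + 1) ∧
        y % (q ^ V) ^ (i + 1) = i ∧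
        Active q M V (K - 1 - i) (2 * (M + 1) ^ i) (y / (q ^ V) ^ (i + 1)) := by
    intro i hi
    have hi := mem_range.1 hi
    -- The lowest spacing is `2` rather than `1` so that `s + 1` falls strictly between inspected
    -- places at every level.
    obtain ⟨h1, h2⟩ := scale_between q M V K 2 (x / q ^ V) i hi.le
    rw [← hs, show K - i = (K - 1 - i) + 1 by omega, scale] at h1 h2
    rw [hdiv] at h1 h2 ⊢
    refine exists_spikes hq hq0 (by positivity) ?_ hsV (hi.trans_le hK) hi hx h1 h2
    rw [Nat.div_div_eq_div_mul, ← pow_mul, ← pow_add]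
    apply hc
    have : V * (i + 1) + V ≤ V * (K + 1) := by
      rw [← mul_add_one]
      exact Nat.mul_le_mul_left _ (by omega)
    omega
  choose! B hB hB' using hex
  -- Spikes of level `i` are congruent to `i` modulo `q ^ V`, so no point is counted for two levels.
  have hdisj : (range K : Set ℕ).PairwiseDisjoint B := by
    intro i hi j hj hij
    have hi' : i ∈ range K := mem_coe.1 hi
    have hj' : j ∈ range K := mem_coe.1 hj
    refine disjoint_left.2 fun y hy hy' => hij ?_
    have hmod : ∀ l ∈ range K, y ∈ B l → y % q ^ V = l := by
      intro l hl hyl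
      have h1 := (hB' l hl y hyl).2.2.2.1
      have h2 : y % (q ^ V) ^ (l + 1) % q ^ V = y % q ^ V :=
        Nat.mod_mod_of_dvd _ (dvd_pow_self _ (Nat.succ_ne_zero l))
      rw [← h2, h1, Nat.mod_eq_of_lt ((mem_range.1 hl).trans_le hK)]
    rw [← hmod i hi' hy, ← hmod j hj' hy']
  refine ⟨((range K).biUnion B).image fun y => y - x, le_of_eq ?_, ?_⟩
  · rw [card_image_of_injOn, card_biUnion hdisj, gain_eq_sum, mul_sum]
    · push_cast
      exact (sum_congr rfl hB).symm
    · intro y hy y' hy' hyy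
      obtain ⟨i, hi, hyi⟩ := mem_biUnion.1 (mem_coe.1 hy)
      obtain ⟨j, hj, hyj⟩ := mem_biUnion.1 (mem_coe.1 hy')
      have h1 := (hB' i hi y hyi).1
      have h2 := (hB' j hj y' hyj).1
      simp only at hyy
      omega
  · intro k hk
    obtain ⟨y, hy, rfl⟩ := mem_image.1 hk
    obtain ⟨i, hi, hyi⟩ := mem_biUnion.1 hy
    obtain ⟨h1, h2, h3, h4, h5⟩ := hB' i hi y hyi
    have h6 : x + (y - x) = y := by omega
    rw [h6]
    refine ⟨by omega, h3, ?_⟩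
    have h7 : 2 * ((q : ℝ) ^ V) ^ (i + 1) ≤ spike q M V K y := by
      refine le_trans (le_of_eq ?_) (single_le_sum (f := fun i => if y % (q ^ V) ^ (i + 1) = i ∧
        Active q M V (K - 1 - i) (2 * (M + 1) ^ i) (y / (q ^ V) ^ (i + 1))
        then 2 * ((q : ℝ) ^ V) ^ (i + 1) else 0) (fun j _ => by split_ifs <;> positivity) hi)
      rw [if_pos ⟨h4, h5⟩]
    have h8 : y - x < 2 * (q ^ V) ^ (i + 1) * q ^ (s + 1) := by omega
    calc ((y - x : ℕ) : ℝ) < ((2 * (q ^ V) ^ (i + 1) * q ^ (s + 1) : ℕ) : ℝ) := by exact_mod_cast h8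
      _ = 2 * ((q : ℝ) ^ V) ^ (i + 1) * q ^ (s + 1) := by push_cast; ring
      _ ≤ _ := by gcongr

/-- The higher digits fix the inspected places; the `M` digits there are then independent and
uniform. -/
lemma sum_active {q M V n U : ℕ} (hq : Even q) (hq0 : 0 < q) (hU : 0 < U)
    (hV : U * (M + 1) ^ (n + 1) ≤ V) :
    (∑ z ∈ range ((q ^ V) ^ (n + 1)), if Active q M V n U z then (1 : ℝ) else 0) =
      ((q : ℝ) ^ V) ^ (n + 1) * (1 / 2) ^ M := by
  rw [pow_succ', sum_range_mul_eq]
  have h1 : ∀ y ∈ range ((q ^ V) ^ n), (∑ D ∈ range (q ^ V),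
      if Active q M V n U (D + q ^ V * y) then (1 : ℝ) else 0) = (q : ℝ) ^ V * (1 / 2) ^ M := by
    intro y _
    have h2 := sum_forall_odd_progression hq hq0 V (scale q M V n (U * (M + 1)) y) U hU (Icc 1 M)
      fun a ha => scale_add_mul_lt hU hV (mem_Icc.1 ha).2
    rw [Nat.card_Icc, Nat.add_sub_cancel] at h2
    rw [← h2]
    refine sum_congr rfl fun D hD => if_congr ?_ rfl rfl
    have hdiv : (D + q ^ V * y) / q ^ V = y := by
      rw [Nat.add_mul_div_left _ _ (pow_pos hq0 V), Nat.div_eq_of_lt (mem_range.1 hD), zero_add]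
    rw [Active, hdiv]
    exact forall₂_congr fun a ha => odd_add_mul_div_pow hq hq0
      (scale_add_mul_lt hU hV (mem_Icc.1 ha).2) D y
  rw [sum_congr rfl h1]
  simp
  ring

/-- Height over spacing is `2` at every level, so only the density `2 ^ (-M)` of active blocks
remains. -/
lemma sum_spike {q M V K : ℕ} (hq : Even q) (hq0 : 0 < q) (hV : 2 * (M + 1) ^ K ≤ V)
    (hK : K ≤ q ^ V) :
    ∑ y ∈ range ((q ^ V) ^ (K + 1)), spike q M V K y =
      ((q : ℝ) ^ V) ^ (K + 1) * (2 * K * (1 / 2) ^ M) := by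
  simp only [spike]
  rw [sum_comm]
  have key : ∀ i ∈ range K, (∑ y ∈ range ((q ^ V) ^ (K + 1)), if y % (q ^ V) ^ (i + 1) = i ∧
      Active q M V (K - 1 - i) (2 * (M + 1) ^ i) (y / (q ^ V) ^ (i + 1))
      then 2 * ((q : ℝ) ^ V) ^ (i + 1) else 0) =
      ((q : ℝ) ^ V) ^ (K + 1) * (2 * (1 / 2) ^ M) := by
    intro i hi
    have hi := mem_range.1 hi
    obtain ⟨r, rfl⟩ := Nat.exists_eq_add_of_lt hi
    have hr : i + r + 1 - 1 - i = r := by omega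
    rw [hr, show (q ^ V) ^ (i + r + 1 + 1) = (q ^ V) ^ (i + 1) * (q ^ V) ^ (r + 1) by ring,
      sum_range_mul_eq]
    have hiP : i < (q ^ V) ^ (i + 1) :=
      lt_of_lt_of_le (hi.trans_le hK) (Nat.le_self_pow (Nat.succ_ne_zero i) _)
    have h1 : ∀ z ∈ range ((q ^ V) ^ (r + 1)), (∑ D ∈ range ((q ^ V) ^ (i + 1)),
        if (D + (q ^ V) ^ (i + 1) * z) % (q ^ V) ^ (i + 1) = i ∧
          Active q M V r (2 * (M + 1) ^ i) ((D + (q ^ V) ^ (i + 1) * z) / (q ^ V) ^ (i + 1))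
        then 2 * ((q : ℝ) ^ V) ^ (i + 1) else 0) = 2 * ((q : ℝ) ^ V) ^ (i + 1) *
          if Active q M V r (2 * (M + 1) ^ i) z then (1 : ℝ) else 0 := by
      intro z _
      have h2 : ∀ D ∈ range ((q ^ V) ^ (i + 1)),
          (if (D + (q ^ V) ^ (i + 1) * z) % (q ^ V) ^ (i + 1) = i ∧
            Active q M V r (2 * (M + 1) ^ i) ((D + (q ^ V) ^ (i + 1) * z) / (q ^ V) ^ (i + 1))
          then 2 * ((q : ℝ) ^ V) ^ (i + 1) else 0) = if D = i then
            2 * ((q : ℝ) ^ V) ^ (i + 1) * (if Active q M V r (2 * (M + 1) ^ i) z then (1 : ℝ) else 0)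
            else 0 := by
        intro D hD
        have hD := mem_range.1 hD
        rw [Nat.add_mul_mod_self_left, Nat.mod_eq_of_lt hD,
          Nat.add_mul_div_left _ _ (by positivity), Nat.div_eq_of_lt hD, zero_add, ite_and]
        simp
      rw [sum_congr rfl h2, sum_ite_eq', if_pos (mem_range.2 hiP)]
    rw [sum_congr rfl h1, ← mul_sum, sum_active hq hq0 (by positivity)]
    · ring
    · refine le_trans (le_of_eq ?_) hV
      ring
  rw [sum_congr rfl key]
  simp
  ring

/-! ### A large set of good points -/

/-- Markov's inequality for `exp (-gain)`: the choice of `K` makes its mean at most `exp (-2 * (1 +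
M / 2))`, half of whose exponent is spent on the threshold. -/
lemma sum_gain_lt_le {q M V K : ℕ} (hq : Even q) (hq0 : 0 < q) (hV : 2 * (M + 1) ^ K ≤ V)
    (hKM : K = 2 ^ (M + 2)) :
    (∑ x ∈ range ((q ^ V) ^ (K + 1)),
      if gain q M V K 2 (x / q ^ V) < 1 + M / 2 then (1 : ℝ) else 0) ≤
      ((q : ℝ) ^ V) ^ (K + 1) / 2 := by
  rw [pow_succ', sum_range_mul_eq]
  have h1 : ∀ y ∈ range ((q ^ V) ^ K), (∑ D ∈ range (q ^ V),
      if gain q M V K 2 ((D + q ^ V * y) / q ^ V) < 1 + M / 2 then (1 : ℝ) else 0) ≤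
      (q : ℝ) ^ V * Real.exp (1 + M / 2) * Real.exp (-gain q M V K 2 y) := by
    intro y _
    have h2 : ∀ D ∈ range (q ^ V),
        (if gain q M V K 2 ((D + q ^ V * y) / q ^ V) < 1 + M / 2 then (1 : ℝ) else 0) ≤
        Real.exp (1 + M / 2) * Real.exp (-gain q M V K 2 y) := by
      intro D hD
      rw [Nat.add_mul_div_left _ _ (pow_pos hq0 V), Nat.div_eq_of_lt (mem_range.1 hD), zero_add,
        ← Real.exp_add]
      split_ifs with h
      · exact Real.one_le_exp (by linarith)
      · positivity
    refine (sum_le_sum h2).trans (le_of_eq ?_)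
    simp [mul_assoc]
  refine (sum_le_sum h1).trans ?_
  rw [← mul_sum]
  have h3 := sum_exp_neg_gain_le (M := M) hq hq0 K 2 (by norm_num) hV
  have h4 : (K : ℝ) * ((1 / 2) ^ M * (1 + M / 2) / 2) = 2 * (1 + M / 2) := by
    have : (2 : ℝ) ^ M * (1 / 2) ^ M = 1 := by rw [← mul_pow]; norm_num
    rw [hKM]
    push_cast
    linear_combination (2 * (1 + (M : ℝ) / 2)) * this
  rw [h4] at h3
  have h5 : Real.exp (1 + M / 2) * Real.exp (-(2 * (1 + M / 2))) ≤ 1 / 2 := by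
    rw [← Real.exp_add, show (1 + (M : ℝ) / 2) + -(2 * (1 + M / 2)) = -(1 + M / 2) by ring,
      Real.exp_neg, one_div]
    apply inv_anti₀ (by norm_num)
    have h6 := Real.add_one_le_exp (1 + (M : ℝ) / 2)
    have h7 : (0 : ℝ) ≤ M := by positivity
    linarith
  calc _ ≤ (q : ℝ) ^ V * Real.exp (1 + M / 2) *
        (((q : ℝ) ^ V) ^ K * Real.exp (-(2 * (1 + M / 2)))) := by gcongr
    _ = ((q : ℝ) ^ V) ^ (K + 1) * (Real.exp (1 + M / 2) * Real.exp (-(2 * (1 + M / 2)))) := by ring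
    _ ≤ ((q : ℝ) ^ V) ^ (K + 1) * (1 / 2) := by gcongr
    _ = _ := by ring

/-- The points of `[0, (q ^ V) ^ (K + 1))` with large gain and no digit that can produce a carry. -/
noncomputable def goodPoints (q M V K : ℕ) : Finset ℕ :=
  (range ((q ^ V) ^ (K + 1))).filter fun x =>
    1 + (M : ℝ) / 2 ≤ gain q M V K 2 (x / q ^ V) ∧ ∀ p < V * (K + 1), x / q ^ p % q ≠ q - 1

lemma card_goodPoints {q M V K : ℕ} (hq : Even q) (hq0 : 0 < q) (hV : 2 * (M + 1) ^ K ≤ V)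
    (hKM : K = 2 ^ (M + 2)) (hqV : 4 * (V * (K + 1)) ≤ q) :
    ((q : ℝ) ^ V) ^ (K + 1) / 4 ≤ #(goodPoints q M V K) := by
  set L := V * (K + 1) with hL
  have h1 := sum_gain_lt_le hq hq0 hV hKM
  have hN : (q ^ V) ^ (K + 1) = q ^ L := by rw [← pow_mul]
  have hNR : ((q : ℝ) ^ V) ^ (K + 1) = (q : ℝ) ^ L := by rw [← pow_mul]
  have h2 : (∑ x ∈ range ((q ^ V) ^ (K + 1)), ∑ p ∈ range L,
      if x / q ^ p % q = q - 1 then (1 : ℝ) else 0) ≤ ((q : ℝ) ^ V) ^ (K + 1) / 4 := by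
    rw [sum_comm, hN, hNR]
    calc _ ≤ ∑ p ∈ range L, (q : ℝ) ^ L / q :=
          sum_le_sum fun p hp => card_filter_digit_eq_le q hq0 L p _ (mem_range.1 hp)
      _ = (q : ℝ) ^ L * (L / q) := by simp; ring
      _ ≤ (q : ℝ) ^ L * (1 / 4) := by
          refine mul_le_mul_of_nonneg_left ?_ (by positivity)
          rw [div_le_div_iff₀ (by positivity) (by norm_num)]
          have : ((4 * L : ℕ) : ℝ) ≤ q := by exact_mod_cast hqV
          push_cast at this
          linarith
      _ = _ := by ring
  -- Union bound: small gain excludes at most one half, carries at most one quarter.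
  have h3 : ∀ x ∈ range ((q ^ V) ^ (K + 1)), (1 : ℝ) ≤
      (if 1 + (M : ℝ) / 2 ≤ gain q M V K 2 (x / q ^ V) ∧ ∀ p < L, x / q ^ p % q ≠ q - 1
        then (1 : ℝ) else 0) +
      (if gain q M V K 2 (x / q ^ V) < 1 + M / 2 then (1 : ℝ) else 0) +
      ∑ p ∈ range L, if x / q ^ p % q = q - 1 then (1 : ℝ) else 0 := by
    intro x _
    have h0 : (0 : ℝ) ≤ ∑ p ∈ range L, if x / q ^ p % q = q - 1 then (1 : ℝ) else 0 :=
      sum_nonneg fun p _ => by split_ifs <;> norm_num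
    by_cases ha : gain q M V K 2 (x / q ^ V) < 1 + M / 2
    · rw [if_pos ha]
      split_ifs <;> linarith
    · rw [if_neg ha]
      by_cases hb : ∀ p < L, x / q ^ p % q ≠ q - 1
      · rw [if_pos ⟨not_lt.1 ha, hb⟩]
        linarith
      · rw [if_neg fun h => hb h.2]
        push Not at hb
        obtain ⟨p, hp, hpq⟩ := hb
        have h4 := single_le_sum (f := fun p => if x / q ^ p % q = q - 1 then (1 : ℝ) else 0)
          (fun p _ => by split_ifs <;> norm_num) (mem_range.2 hp)
        simp only [hpq, if_true] at h4
        linarith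
  have h4 := sum_le_sum h3
  rw [sum_add_distrib, sum_add_distrib, sum_boole] at h4
  simp only [sum_const, card_range, nsmul_eq_mul, mul_one, Nat.cast_pow] at h4
  have h5 : ((#(goodPoints q M V K) : ℕ) : ℝ) = #((range ((q ^ V) ^ (K + 1))).filter fun x =>
    1 + (M : ℝ) / 2 ≤ gain q M V K 2 (x / q ^ V) ∧ ∀ p < L, x / q ^ p % q ≠ q - 1) := rfl
  rw [h5]
  linarith

/-! ### Transfer to the circle -/

/-- The index of the interval of length `1 / N` that contains `x`. -/
noncomputable def cell (N : ℕ) (x : UnitAddCircle) : ℕ := ⌊(N : ℝ) * (AddCircle.equivIco 1 0 x : ℝ)⌋₊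

lemma measurable_cell (N : ℕ) : Measurable (cell N) :=
  Nat.measurable_floor.comp (measurable_const.mul
    (measurable_subtype_coe.comp (AddCircle.measurableEquivIco 1 0).measurable))

lemma cell_lt {N : ℕ} (hN : 0 < N) (x : UnitAddCircle) : cell N x < N := by
  have h := (AddCircle.equivIco 1 0 x).2
  have hN' : (0 : ℝ) < N := by exact_mod_cast hN
  rw [cell, Nat.floor_lt (mul_nonneg hN'.le h.1)]
  nlinarith [h.2]

lemma cell_coe (N : ℕ) {t : ℝ} (ht : t ∈ Set.Ico (0 : ℝ) 1) :
    cell N (t : UnitAddCircle) = ⌊(N : ℝ) * t⌋₊ := by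
  rw [cell, AddCircle.equivIco_coe_of_mem (by simpa using ht)]

lemma volume_cell_eq {N y : ℕ} (hy : y < N) :
    volume (cell N ⁻¹' {y}) = (N : ℝ≥0∞)⁻¹ := by
  have hN : (0 : ℝ) < N := by exact_mod_cast (Nat.zero_le y).trans_lt hy
  have h := UnitAddCircle.measurePreserving_mk 0
  rw [← h.measure_preimage (measurable_cell N (measurableSet_singleton y)).nullMeasurableSet,
    zero_add, Measure.restrict_congr_set Ico_ae_eq_Ioc.symm,
    Measure.restrict_apply (h.measurable (measurable_cell N (measurableSet_singleton y)))]
  have h2 : ((↑) : ℝ → UnitAddCircle) ⁻¹' (cell N ⁻¹' {y}) ∩ Set.Ico 0 1 =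
      Set.Ico ((y : ℝ) / N) ((y + 1) / N) := by
    have hy' : ((y : ℝ) + 1) ≤ N := by exact_mod_cast hy
    ext t
    simp only [Set.mem_inter_iff, Set.mem_preimage, Set.mem_singleton_iff, Set.mem_Ico]
    rw [div_le_iff₀ hN, lt_div_iff₀ hN]
    constructor
    · rintro ⟨h3, h4⟩
      rw [cell_coe N h4, Nat.floor_eq_iff (mul_nonneg hN.le h4.1)] at h3
      constructor <;> linarith [h3.1, h3.2]
    · rintro ⟨h3, h4⟩
      have hy0 : (0 : ℝ) ≤ y := by positivity
      have h5 : 0 ≤ t := by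
        by_contra! hlt
        nlinarith
      have h6 : t < 1 := by
        by_contra! hlt
        nlinarith
      refine ⟨?_, h5, h6⟩
      rw [cell_coe N ⟨h5, h6⟩, Nat.floor_eq_iff (mul_nonneg hN.le h5)]
      constructor <;> linarith
  rw [h2, Real.volume_Ico, ← sub_div, add_sub_cancel_left, one_div, ENNReal.ofReal_inv_of_pos hN,
    ENNReal.ofReal_natCast]

lemma lintegral_comp_cell {N : ℕ} (hN : 0 < N) (F : ℕ → ℝ≥0∞) :
    ∫⁻ x, F (cell N x) = (∑ y ∈ range N, F y) * (N : ℝ≥0∞)⁻¹ := by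
  rw [← lintegral_map (μ := (volume : Measure UnitAddCircle)) (measurable_of_countable F)
    (measurable_cell N), lintegral_countable', tsum_eq_sum (s := range N), sum_mul]
  · refine sum_congr rfl fun y hy => ?_
    rw [Measure.map_apply (measurable_cell N) (measurableSet_singleton y),
      volume_cell_eq (mem_range.1 hy)]
  · intro y hy
    rw [Measure.map_apply (measurable_cell N) (measurableSet_singleton y)]
    have : cell N ⁻¹' {y} = ∅ := by
      ext x
      simp only [Set.mem_preimage, Set.mem_singleton_iff, Set.mem_empty_iff_false, iff_false]
      rintro rfl
      exact hy (mem_range.2 (cell_lt hN x))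
    rw [this, measure_empty, mul_zero]

lemma volume_cell_mem {N : ℕ} (G : Finset ℕ) (hG : ∀ y ∈ G, y < N) (hN : 0 < N) :
    volume {x | cell N x ∈ G} = (#G : ℝ≥0∞) * (N : ℝ≥0∞)⁻¹ := by
  have h1 : MeasurableSet {x | cell N x ∈ G} := 
    measurable_cell N (Set.to_countable (G : Set ℕ)).measurableSet
  rw [← lintegral_indicator_one h1]
  have h2 := lintegral_comp_cell hN (fun y => if y ∈ G then 1 else 0)
  have h3 : (range N).filter (· ∈ G) = G := by
    ext y
    simp only [mem_filter, mem_range]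
    exact ⟨fun h => h.2, fun h => ⟨hG y h, h⟩⟩
  rw [sum_boole, h3] at h2
  rw [← h2]
  refine lintegral_congr fun x => ?_
  simp [Set.indicator_apply]

/-- The hypothesis rules out wrapping around the circle. -/
lemma cell_dyadicRotation {J : ℕ} {x : UnitAddCircle} (h : cell (2 ^ J) x + 1 < 2 ^ J) :
    cell (2 ^ J) (dyadicRotation J x) = cell (2 ^ J) x + 1 := by
  set t : ℝ := (AddCircle.equivIco 1 0 x : ℝ) with ht
  have hx : (t : UnitAddCircle) = x := AddCircle.coe_equivIco
  have ht' : t ∈ Set.Ico (0 : ℝ) 1 := by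
    simpa using (AddCircle.equivIco 1 0 x).2
  rw [← hx, cell_coe _ ht'] at h ⊢
  have hJ : (0 : ℝ) < 2 ^ J := by positivity
  have hinv : (2 : ℝ) ^ J * ((2 : ℝ) ^ J)⁻¹ = 1 := mul_inv_cancel₀ hJ.ne'
  have h1 : t + ((2 : ℝ) ^ J)⁻¹ ∈ Set.Ico (0 : ℝ) 1 := by
    have h2 := Nat.lt_floor_add_one (((2 ^ J : ℕ) : ℝ) * t)
    have h3 : ((⌊((2 ^ J : ℕ) : ℝ) * t⌋₊ : ℕ) : ℝ) + 1 + 1 ≤ 2 ^ J := by exact_mod_cast h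
    push_cast at h2 h3
    refine ⟨add_nonneg ht'.1 (by positivity), ?_⟩
    by_contra! hlt
    nlinarith [mul_le_mul_of_nonneg_left hlt hJ.le]
  rw [dyadicRotation, ← AddCircle.coe_add, cell_coe _ h1]
  push_cast
  rw [mul_add, hinv, Nat.floor_add_one (mul_nonneg hJ.le ht'.1)]

lemma cell_iterate_dyadicRotation {J k : ℕ} {x : UnitAddCircle} (h : cell (2 ^ J) x + k < 2 ^ J) :
    cell (2 ^ J) ((dyadicRotation J)^[k] x) = cell (2 ^ J) x + k := by
  induction k with
  | zero => simp
  | succ k ih =>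
    have ih' := ih (by omega)
    rw [Function.iterate_succ_apply', cell_dyadicRotation (by omega), ih', add_assoc]

/-! ### The weak type constants of the dyadic rotations -/

lemma le_weakTypeConst {X : Type*} [MeasurableSpace X] {μ : Measure X} {T : X → X} {f : X → ℝ}
    (hf : Integrable f μ) (h0 : 0 ≤ᵐ[μ] f) (h1 : eLpNorm f 1 μ = 1) {lam : ℝ≥0} (hlam : 0 < lam) :
    (lam : ℝ≥0∞) * μ {x | maximalCount T f x > (lam : ℝ≥0∞)} ≤ weakTypeConst μ T :=
  le_iSup_of_le f <| le_iSup_of_le hf <| le_iSup_of_le h0 <| le_iSup_of_le h1 <|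
    le_iSup_of_le lam <| le_iSup_of_le hlam le_rfl

lemma lt_maximalCount {X : Type*} {T : X → X} {f : X → ℝ} {x : X} {lam : ℝ≥0} {n : ℕ} (hn : 1 ≤ n)
    (B : Finset ℕ) (hB : ∀ k ∈ B, 1 ≤ k ∧ f (T^[k] x) / (k : ℝ) > 1 / (n : ℝ))
    (hlt : (lam : ℝ) * n < #B) : (lam : ℝ≥0∞) < maximalCount T f x := by
  refine lt_of_lt_of_le ?_ (le_iSup₂_of_le n hn le_rfl)
  have h1 : ((#B : ℕ) : ℕ∞) ≤ count T f n x := by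
    rw [← Set.encard_coe_eq_coe_finsetCard]
    exact Set.encard_le_encard fun k hk => hB k hk
  have h2 : ((#B : ℕ) : ℝ≥0∞) ≤ (count T f n x : ℝ≥0∞) := by
    have := ENat.toENNReal_mono h1
    simpa using this
  have hn0 : (n : ℝ≥0∞) ≠ 0 := by
    simp only [ne_eq, Nat.cast_eq_zero]
    omega
  refine lt_of_lt_of_le ?_ (ENNReal.div_le_div_right h2 _)
  rw [ENNReal.lt_div_iff_mul_lt (Or.inl hn0) (Or.inl (ENNReal.natCast_ne_top n))]
  have h3 : lam * (n : ℝ≥0) < ((#B : ℕ) : ℝ≥0) := by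
    rw [← NNReal.coe_lt_coe]
    push_cast
    exact hlt
  exact_mod_cast h3

lemma eLpNorm_comp_cell {N : ℕ} (hN : 0 < N) (g : ℕ → ℝ) (hg : ∀ y, 0 ≤ g y)
    (hsum : ∑ y ∈ range N, g y = N) :
    eLpNorm (fun x => g (cell N x)) 1 (volume : Measure UnitAddCircle) = 1 := by
  rw [eLpNorm_one_eq_lintegral_enorm, lintegral_comp_cell hN fun y => ‖g y‖ₑ]
  have h1 : ∑ y ∈ range N, ‖g y‖ₑ = N := by
    rw [← ENNReal.ofReal_natCast, ← hsum, ENNReal.ofReal_sum_of_nonneg fun y _ => hg y]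
    exact sum_congr rfl fun y _ => Real.enorm_of_nonneg (hg y)
  rw [h1]
  exact ENNReal.mul_inv_cancel (by simpa using hN.ne') (ENNReal.natCast_ne_top N)

lemma exists_le_weakTypeConst (M : ℕ) : ∃ J : ℕ,
    (((M : ℝ≥0) / 64 : ℝ≥0) : ℝ≥0∞) ≤
      weakTypeConst (volume : Measure UnitAddCircle) (dyadicRotation J) := by
  obtain ⟨K, hKM⟩ : ∃ K, K = 2 ^ (M + 2) := ⟨_, rfl⟩
  obtain ⟨V, hV⟩ : ∃ V, V = 2 * (M + 1) ^ K := ⟨_, rfl⟩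
  -- A power of two for `q` makes the number of cells `2 ^ J`; `q = 2 ^ w > w` gives the bound
  -- required against carries.
  obtain ⟨w, hw⟩ : ∃ w, w = 4 * (V * (K + 1)) := ⟨_, rfl⟩
  obtain ⟨q, hqw⟩ : ∃ q, q = 2 ^ w := ⟨_, rfl⟩
  have hV0 : 0 < V := by rw [hV]; positivity
  have hw0 : w ≠ 0 := by rw [hw]; positivity
  have hq : Even q := hqw ▸ even_two.pow_of_ne_zero hw0
  have hwq : w < q := hqw ▸ Nat.lt_two_pow_self
  have hq0 : 0 < q := by omega
  have hKq : K ≤ q ^ V := by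
    have h1 : K + 1 ≤ V * (K + 1) := Nat.le_mul_of_pos_left _ hV0
    have h2 : q ≤ q ^ V := Nat.le_self_pow hV0.ne' q
    omega
  refine ⟨w * (V * (K + 1)), ?_⟩
  set J := w * (V * (K + 1)) with hJ
  have hN : (q ^ V) ^ (K + 1) = 2 ^ J := by rw [hqw, ← pow_mul, ← pow_mul]
  have hNR : ((q : ℝ) ^ V) ^ (K + 1) = 2 ^ J := by exact_mod_cast hN
  have hJ0 : 0 < 2 ^ J := by positivity
  set g : ℕ → ℝ := fun y => spike q M V K y / 8 with hg
  have hg0 : ∀ y, 0 ≤ g y := fun y => div_nonneg (spike_nonneg ..) (by norm_num)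
  have hsum : ∑ y ∈ range (2 ^ J), g y = ((2 ^ J : ℕ) : ℝ) := by
    rw [hg, ← sum_div, ← hN, sum_spike hq hq0 hV.ge hKq, hKM]
    have : (2 : ℝ) ^ M * (1 / 2) ^ M = 1 := by rw [← mul_pow]; norm_num
    push_cast
    linear_combination (((q : ℝ) ^ V) ^ (2 ^ (M + 2) + 1)) * this
  set f : UnitAddCircle → ℝ := fun x => g (cell (2 ^ J) x) with hf
  have hnorm : eLpNorm f 1 volume = 1 := eLpNorm_comp_cell hJ0 g hg0 hsum
  have hfm : Measurable f := (measurable_of_countable g).comp (measurable_cell _)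
  have hfint : Integrable f volume :=
    memLp_one_iff_integrable.1 ⟨hfm.aestronglyMeasurable, by rw [hnorm]; exact ENNReal.one_lt_top⟩
  have hlam : (0 : ℝ≥0) < ((M : ℝ≥0) + 1) / 16 := by positivity
  refine le_trans ?_ (le_weakTypeConst hfint (ae_of_all _ fun x => hg0 _) hnorm hlam)
  have hsub : {x | cell (2 ^ J) x ∈ goodPoints q M V K} ⊆
      {x | maximalCount (dyadicRotation J) f x > ((((M : ℝ≥0) + 1) / 16 : ℝ≥0) : ℝ≥0∞)} := by
    intro x hx
    obtain ⟨hxN, hgain, hcarry⟩ := mem_filter.1 (show cell (2 ^ J) x ∈ goodPoints q M V K from hx)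
    obtain ⟨B, hB, hB'⟩ :=
      exists_many_large_spikes hq hq0 hV.ge hKq (mem_range.1 hxN) hcarry
    set n := q ^ (scale q M V K 2 (cell (2 ^ J) x / q ^ V) + 1) with hn
    have hn0 : 0 < n := by positivity
    have hnR : (0 : ℝ) < n := by exact_mod_cast hn0
    have hncast : (q : ℝ) ^ (scale q M V K 2 (cell (2 ^ J) x / q ^ V) + 1) = n := by
      rw [hn]
      push_cast
      rfl
    rw [hncast] at hB hB'
    -- The factor `8` undoes the normalisation of `spike`. The count over `8 * n` is at least `(1 +
    -- M / 2) / 8`, which exceeds `(M + 1) / 16`.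
    refine lt_maximalCount (n := 8 * n) (by omega) B ?_ ?_
    · intro k hk
      obtain ⟨h1, h2, h3⟩ := hB' k hk
      refine ⟨h1, ?_⟩
      rw [hN] at h2
      have hk0 : (0 : ℝ) < k := by exact_mod_cast h1
      simp only [hf, hg]
      rw [cell_iterate_dyadicRotation h2, gt_iff_lt, div_div,
        div_lt_div_iff₀ (by push_cast; positivity) (by positivity)]
      push_cast
      linarith
    · push_cast
      have h1 : (n : ℝ) * (1 + M / 2) ≤ #B := (mul_le_mul_of_nonneg_left hgain hnR.le).trans hB
      linarith
  refine le_trans ?_ (mul_le_mul_right (measure_mono hsub) _)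
  rw [volume_cell_mem (goodPoints q M V K) (fun y hy => hN ▸ mem_range.1 (mem_filter.1 hy).1) hJ0]
  have hcard := card_goodPoints hq hq0 hV.ge hKM (by omega)
  rw [hNR] at hcard
  have h1 : ((M : ℝ≥0) / 64 : ℝ≥0) ≤
      ((M : ℝ≥0) + 1) / 16 * ((#(goodPoints q M V K) : ℝ≥0) * ((2 ^ J : ℕ) : ℝ≥0)⁻¹) := by
    rw [← NNReal.coe_le_coe]
    push_cast
    have h2 : (1 / 4 : ℝ) ≤ #(goodPoints q M V K) * ((2 : ℝ) ^ J)⁻¹ := by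
      rw [← div_eq_mul_inv, le_div_iff₀ (by positivity)]
      linarith
    have h3 : (0 : ℝ) ≤ M := by positivity
    nlinarith
  have h2 := ENNReal.coe_le_coe.2 h1
  have h3 : ((2 ^ J : ℕ) : ℝ≥0) ≠ 0 := by positivity
  rw [ENNReal.coe_mul, ENNReal.coe_mul, ENNReal.coe_inv h3] at h2
  exact h2

lemma iSup_weakTypeConst_dyadicRotation :
    (⨆ J : ℕ, weakTypeConst (volume : Measure UnitAddCircle) (dyadicRotation J)) = ∞ := by
  refine ENNReal.eq_top_of_forall_nnreal_le fun r => ?_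
  obtain ⟨M, hM⟩ := exists_nat_ge (r * 64)
  obtain ⟨J, hJ⟩ := exists_le_weakTypeConst M
  refine le_trans (le_trans ?_ hJ) (le_iSup (fun J => weakTypeConst volume (dyadicRotation J)) J)
  rw [ENNReal.coe_le_coe, le_div_iff₀ (by norm_num)]
  exact hM

end CountingProblem

/-- The supremum of the weak type (1,1) constants over all invertible measure preserving systems on
probability spaces is infinite, and it is infinite already over the dyadic rotations of the circle
with Lebesgue measure. -/
theorem theorem1 :
    (⨆ (X : Type) (_ : MeasurableSpace X) (μ : Measure X) (_ : IsProbabilityMeasure μ)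
        (T : X ≃ᵐ X) (_ : MeasurePreserving T μ μ),
        CountingProblem.weakTypeConst μ T) = ∞ ∧
      (⨆ J : ℕ, CountingProblem.weakTypeConst (volume : Measure UnitAddCircle)
        (CountingProblem.dyadicRotation J)) = ∞ := by
  refine ⟨?_, CountingProblem.iSup_weakTypeConst_dyadicRotation⟩
  rw [eq_top_iff, ← CountingProblem.iSup_weakTypeConst_dyadicRotation]
  refine iSup_le fun J => ?_
  exact le_iSup_of_le UnitAddCircle <| le_iSup_of_le inferInstance <|
    le_iSup_of_le (volume : Measure UnitAddCircle) <|
    le_iSup_of_le ⟨UnitAddCircle.measure_univ⟩ <|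
    le_iSup_of_le (MeasurableEquiv.addRight ((((2 : ℝ) ^ J)⁻¹ : ℝ) : UnitAddCircle)) <|
    le_iSup_of_le (measurePreserving_add_right volume _) le_rfl
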